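/- Let $K$ be a number field, let $R\subset K$ be the ring of $S$-integers for a finite set $S$ of primes of $K$ (containing the archimedean ones), and let $Q(x)=Ax^2+Bx+C\in R[x]$ with $B^2-4AC\neq 0$; that is, the multiset $\mathcal{B}=\{\beta,\beta^*\}$ of roots of $Q$ (in $\mathbb{P}^1$, the root $\infty$ being allowed) consists of two distinct elements. Put $D(a)=\left[\begin{smallmatrix}a&1\\1&0\end{smallmatrix}\right]$ and $t=\left[\begin{smallmatrix}0&1\\1&0\end{smallmatrix}\right]$. For $N\ge 0$, $k\ge 1$ let $$E=D(b_1)\cdots D(b_N)\,D(a_1)\cdots D(a_k)\,t\,D(-b_N)\cdots D(-b_1)\,t ,$$ and let $V(\mathcal{B})_{N,k}\subseteq\mathbb{A}^{N}\times\mathbb{A}^{k}$ be the closed subscheme, in the coordinates $b_1,\dots,b_N,a_1,\dots,a_k$, given by the equations $$B E_{21}=A(E_{22}-E_{11}),\qquad -A E_{12}=C E_{21},\qquad -B E_{12}=C(E_{22}-E_{11}),$$ which say that $E_{21}x^2+(E_{22}-E_{11})x-E_{12}$ is proportional to $Q$. Let $FP_k(\mathcal{B})\subseteq\mathbb{A}^4$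 be the Fermat–Pell curve $$ad-bc=(-1)^k,\qquad Bc=A(d-a),\qquad -Ab=Cc,\qquad -Bb=C(d-a).$$ (a) If $k\ge 5$, then $V(\mathcal{B})_{1,k}$ is integral (irreducible and reduced) over $K$; if moreover $FP_k(\mathcal{B})$ has a $K$-point, then $V(\mathcal{B})_{1,k}$ is rational over $K$, i.e. birational over $K$ to an affine space over $K$. (b) If $k\ge 6$, then $V(\mathcal{B})_{0,k}$ is integral over $K$; if moreover $FP_k(\mathcal{B})$ has a $K$-point, then $V(\mathcal{B})_{0,k}$ is rational over $K$. -/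

import Mathlib

namespace PCF

universe u

/-- The matrix `D(x) = [[x, 1], [1, 0]]`. -/
def D {F : Type u} [CommRing F] (x : F) : Matrix (Fin 2) (Fin 2) F := !![x, 1; 1, 0]

/-- The matrix `t = [[0, 1], [1, 0]]`. -/
def t (F : Type u) [CommRing F] : Matrix (Fin 2) (Fin 2) F := !![0, 1; 1, 0]

/-- The matrix
`E(P) = D(b₁) ⋯ D(b_N) D(a₁) ⋯ D(a_k) t D(-b_N) ⋯ D(-b₁) t`
attached to the periodic continued fraction `P = [b₁, …, b_N, (a₁, …, a_k) repeated]`.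
The associated quadratic polynomial is `E₂₁ x² + (E₂₂ - E₁₁) x - E₁₂`. -/
def matE {F : Type u} [CommRing F] {N k : ℕ} (b : Fin N → F) (a : Fin k → F) :
    Matrix (Fin 2) (Fin 2) F :=
  (List.ofFn fun i => D (b i)).prod * (List.ofFn fun i => D (a i)).prod * t F *
    (List.ofFn fun i => D (-b (Fin.rev i))).prod * t F

/-- The points over a commutative ring `F` of the Fermat-Pell curve `FP_k(Q)`, for
`Q = A x² + B x + C`: the matrices `[[a, b], [c, d]]` with
`ad - bc = (-1)^k`, `B c = A (d - a)`, `-A b = C c` and `-B b = C (d - a)`. -/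
def fermatPell {F : Type u} [CommRing F] (A B C : F) (k : ℕ) : Set (Matrix (Fin 2) (Fin 2) F) :=
  {M | M 0 0 * M 1 1 - M 0 1 * M 1 0 = (-1) ^ k ∧
    B * M 1 0 = A * (M 1 1 - M 0 0) ∧
    -A * M 0 1 = C * M 1 0 ∧
    -B * M 0 1 = C * (M 1 1 - M 0 0)}

/-- The matrix `E` at the generic point `(b₁, …, b_N, a₁, …, a_k)` of `𝔸^{N,k}`;
the coordinate functions `bᵢ` and `aⱼ` are the variables `inl i` and `inr j`. -/
noncomputable def genericE (F : Type u) [CommRing F] (N k : ℕ) :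
    Matrix (Fin 2) (Fin 2) (MvPolynomial (Fin N ⊕ Fin k) F) :=
  matE (fun i => MvPolynomial.X (Sum.inl i)) (fun j => MvPolynomial.X (Sum.inr j))

/-- The ideal of `V(Q)_{N,k}` in the coordinate ring of `𝔸^{N,k}`, for `Q = A x² + B x + C`. It is
generated by the 2×2 minors expressing that `E₂₁ x² + (E₂₂ - E₁₁) x - E₁₂` is proportional to `Q`.
(The determinant of `E` is identically `(-1)^k`.) -/
noncomputable def idealV {F : Type u} [CommRing F] (A B C : F) (N k : ℕ) :
    Ideal (MvPolynomial (Fin N ⊕ Fin k) F) :=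
  let E := genericE F N k
  Ideal.span
    {MvPolynomial.C B * E 1 0 - MvPolynomial.C A * (E 1 1 - E 0 0),
      -MvPolynomial.C A * E 0 1 - MvPolynomial.C C * E 1 0,
      -MvPolynomial.C B * E 0 1 - MvPolynomial.C C * (E 1 1 - E 0 0)}

open AlgebraicGeometry in
/-- The PCF variety `V(Q)_{N,k}`, `Q = A x² + B x + C`, as a closed subscheme of `𝔸^{N,k}`
over `F`. -/
noncomputable def V {F : Type u} [CommRing F] (A B C : F) (N k : ℕ) : Scheme.{u} :=
  Spec (CommRingCat.of (MvPolynomial (Fin N ⊕ Fin k) F ⧸ idealV A B C N k))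

open AlgebraicGeometry in
/-- The structure morphism `V(Q)_{N,k} ⟶ Spec F`. -/
noncomputable def V.structureMap {F : Type u} [CommRing F] (A B C : F) (N k : ℕ) :
    V A B C N k ⟶ Spec (CommRingCat.of F) :=
  Spec.map (CommRingCat.ofHom
    (algebraMap F (MvPolynomial (Fin N ⊕ Fin k) F ⧸ idealV A B C N k)))

end PCF

/-! Since `E` is the conjugate of D(a₀)⋯D(a_{k-1}) by D(b₁)⋯D(b_N), a point of V is a matrix M =
[[x, -Cy], [Ay, x+By]] on the Fermat–Pell conic x² + Bxy + ACy² = (-1)^k together with such a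
factorization of M. Fix M, the bᵢ and a₃, …, a_{k-1}. Then D(a₀)D(a₁)D(a₂) must equal a known matrix
P of determinant -1 (`headMatrix`), which forces a₁ = P₁₁ and a₂ = P₀₀ - a₀P₁₀ and leaves the single
equation P₁₁a₀ = P₀₁ - 1 (indices from 0). So V is the hypersurface pX = r, with p = P₁₁ and r = P₀₁
- 1, over T, the coordinate ring of FP × 𝔸^{N+k-3}.

If p, r is a regular sequence in the domain T, then pX - r generates the kernel of T[X] → Frac T, X
↦ r/p (`dvd_of_aeval_div_eq_zero`). The coordinate ring of V is then a domain between T and Frac T,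
so V is integral and birational to FP × 𝔸^{N+k-3} (`exists_coordRing_embedding`).

Regularity is read off from the dependence on a₃: p = s - qa₃ and r = u - va₃ - 1 with uq - vs = 1.
At a₃ = s/q the second becomes 1/q - 1, so q ≠ 0, 1 suffices (`linear_dvd_of_dvd_mul`). This holds
once some aⱼ with j ≥ 4 exists, that is for k ≥ 5 and every N (`tailMatrix_apply_ne`).

T is a domain because B² ≠ 4AC makes the conic irreducible. A K-point on the conic parametrizes it
by lines (`ConicRing.exists_parametrization`), and V becomes rational. -/

namespace PCF

universe u

/-! ### Rings with the same fractions -/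

section Fractions

variable {K R S : Type*} [Field K] [CommRing R] [CommRing S] [IsDomain R] [Algebra K R]
  [Algebra K S]

/-- The element `s` is a fraction of elements in the image of `φ`. -/
def IsFractionOf (φ : R →ₐ[K] S) (s : S) : Prop := ∃ d, d ≠ 0 ∧ ∃ n, φ d * s = φ n

namespace IsFractionOf

variable {φ : R →ₐ[K] S}

theorem of_apply (r : R) : IsFractionOf φ (φ r) := ⟨1, one_ne_zero, r, by simp⟩

theorem add {s t : S} (hs : IsFractionOf φ s) (ht : IsFractionOf φ t) :
    IsFractionOf φ (s + t) := by
  obtain ⟨d, hd, n, h⟩ := hs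
  obtain ⟨e, he, m, h'⟩ := ht
  refine ⟨d * e, mul_ne_zero hd he, e * n + d * m, ?_⟩
  simp only [map_add, map_mul]
  linear_combination φ e * h + φ d * h'

theorem mul {s t : S} (hs : IsFractionOf φ s) (ht : IsFractionOf φ t) :
    IsFractionOf φ (s * t) := by
  obtain ⟨d, hd, n, h⟩ := hs
  obtain ⟨e, he, m, h'⟩ := ht
  refine ⟨d * e, mul_ne_zero hd he, n * m, ?_⟩
  simp only [map_mul]
  linear_combination φ e * t * h + φ n * h'

/-- If z = s'/s with s = n/d and s' = m/e, then z = dm/(en); injectivity of `φ` keeps n nonzero. -/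
theorem trans [IsDomain S] {L : Type*} [CommRing L] [Algebra K L] {ψ : S →ₐ[K] L}
    (hφ : Function.Injective φ) (hS : ∀ s, IsFractionOf φ s) {z : L} (hz : IsFractionOf ψ z) :
    IsFractionOf (ψ.comp φ) z := by
  obtain ⟨s, hs, s', h⟩ := hz
  obtain ⟨d, hd, n, h1⟩ := hS s
  obtain ⟨e, he, m, h2⟩ := hS s'
  have hn : n ≠ 0 := by
    rintro rfl
    rw [map_zero, mul_eq_zero, map_eq_zero_iff φ hφ] at h1
    exact h1.elim hd hs
  refine ⟨e * n, mul_ne_zero he hn, d * m, ?_⟩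
  simp only [AlgHom.comp_apply, map_mul, ← h1, ← h2]
  linear_combination ψ (φ e) * ψ (φ d) * h

theorem of_div {L : Type*} [Field L] [Algebra K L] {φ : R →ₐ[K] L} (a b : R) :
    IsFractionOf φ (φ a / φ b) := by
  by_cases h : φ b = 0
  -- Division by zero gives 0, which is the fraction 0/1.
  · exact ⟨1, one_ne_zero, 0, by simp [h]⟩
  · exact ⟨b, fun hb => h (by simp [hb]), a, by field_simp⟩

theorem polynomial_map (hφ : ∀ s, IsFractionOf φ s) (p : Polynomial S) :
    IsFractionOf (Polynomial.mapAlgHom φ) p := by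
  have hC : ∀ s, IsFractionOf (Polynomial.mapAlgHom φ) (Polynomial.C s) := fun s => by
    obtain ⟨d, hd, n, h⟩ := hφ s
    exact ⟨Polynomial.C d, by simpa using hd, Polynomial.C n, by simp [← h]⟩
  have hX : IsFractionOf (Polynomial.mapAlgHom φ) Polynomial.X := by
    simpa using of_apply (φ := Polynomial.mapAlgHom φ) Polynomial.X
  induction p using Polynomial.induction_on with
  | C a => exact hC a
  | add p q hp hq => exact hp.add hq
  | monomial n a h => rw [pow_succ, ← mul_assoc]; exact h.mul hX

theorem mvPolynomial_map {σ : Type*} (hφ : ∀ s, IsFractionOf φ s) (p : MvPolynomial σ S) :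
    IsFractionOf (MvPolynomial.mapAlgHom (σ := σ) φ) p := by
  induction p using MvPolynomial.induction_on with
  | C s =>
    obtain ⟨d, hd, n, h⟩ := hφ s
    exact ⟨MvPolynomial.C d, by simpa using hd, MvPolynomial.C n, by simp [← h]⟩
  | add p q hp hq => exact hp.add hq
  | mul_X p i h =>
    have hX : IsFractionOf (MvPolynomial.mapAlgHom (σ := σ) φ) (MvPolynomial.X i) := by
      simpa using of_apply (φ := MvPolynomial.mapAlgHom (σ := σ) φ) (MvPolynomial.X i)
    exact h.mul hX

end IsFractionOf

theorem isFractionOf_toAlgHom [Algebra R S] [IsScalarTower K R S] [IsFractionRing R S] (z : S) :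
    IsFractionOf (IsScalarTower.toAlgHom K R S) z := by
  obtain ⟨⟨n, d⟩, h⟩ := IsLocalization.surj (nonZeroDivisors R) z
  exact ⟨d, nonZeroDivisors.ne_zero d.2, n, by rw [mul_comm]; exact h⟩

end Fractions

/-! ### Birationality from equality of function fields -/

section Birational

open AlgebraicGeometry CategoryTheory

/-- An injective map of domains `P → Q`, with `Q` of finite type over a field and every element of
`Q` a fraction of elements of `P`, becomes bijective after inverting one element of `P`. -/
theorem exists_awayMap_bijective {K P Q : Type u} [Field K] [CommRing P] [CommRing Q]
    [IsDomain P] [IsDomain Q] [Algebra K P] [Algebra K Q] [Algebra.FiniteType K Q]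
    (φ : P →ₐ[K] Q) (hφ : Function.Injective φ)
    (h : ∀ q, IsFractionOf φ q) :
    ∃ d : P, d ≠ 0 ∧ Function.Bijective (Localization.awayMap φ.toRingHom d) := by
  obtain ⟨s, hs⟩ := Algebra.FiniteType.out (R := K) (A := Q)
  choose den hden num hnum using h
  -- A common denominator of a finite set of generators is enough to invert.
  refine ⟨∏ q ∈ s, den q, Finset.prod_ne_zero_iff.2 fun q _ => hden q, ?_, ?_⟩
  · rw [Localization.awayMap_injective_iff]
    intro a ha
    exact ⟨0, by simpa using (map_eq_zero_iff φ hφ).1 ha⟩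
  · rw [Localization.awayMap_surjective_iff]
    change ∀ a, ∃ b m, φ b = φ (∏ q ∈ s, den q) ^ m * a
    set d := ∏ q ∈ s, den q with hd
    intro a
    have ha : a ∈ Algebra.adjoin K (s : Set Q) := hs ▸ Algebra.mem_top
    induction ha using Algebra.adjoin_induction with
    | mem x hx =>
      classical
      refine ⟨(∏ q ∈ s.erase x, den q) * num x, 1, ?_⟩
      rw [hd, ← Finset.prod_erase_mul s den hx, map_mul, ← hnum]
      simp [mul_assoc]
    | algebraMap r => exact ⟨algebraMap K P r, 0, by simp⟩
    | add x y _ _ hx hy =>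
      obtain ⟨b, m, hb⟩ := hx
      obtain ⟨c, n, hc⟩ := hy
      refine ⟨d ^ n * b + d ^ m * c, m + n, ?_⟩
      simp only [map_add, map_mul, map_pow, hb, hc]
      ring
    | mul x y _ _ hx hy =>
      obtain ⟨b, m, hb⟩ := hx
      obtain ⟨c, n, hc⟩ := hy
      refine ⟨b * c, m + n, ?_⟩
      simp only [map_mul, hb, hc]
      ring

/-- An injective map of domains, with target of finite type over a field and consisting of fractions
of elements of the source, induces a birational morphism. -/
theorem birationalOver_of_fractions {K P Q : Type u} [Field K] [CommRing P] [CommRing Q]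
    [IsDomain P] [IsDomain Q] [Algebra K P] [Algebra K Q] [Algebra.FiniteType K Q]
    (φ : P →ₐ[K] Q) (hφ : Function.Injective φ)
    (h : ∀ q, IsFractionOf φ q) :
    Scheme.BirationalOver (Spec.map (CommRingCat.ofHom (algebraMap K Q)))
      (Spec.map (CommRingCat.ofHom (algebraMap K P))) := by
  obtain ⟨d, hd, hbij⟩ := exists_awayMap_bijective φ hφ h
  let f : CommRingCat.of P ⟶ CommRingCat.of Q := CommRingCat.ofHom φ.toRingHom
  let U : (Spec (CommRingCat.of P)).Opens := PrimeSpectrum.basicOpen d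
  have hiso : IsIso (Spec.map f ∣_ U) := by
    have : IsIso (CommRingCat.ofHom (Localization.awayMap f.hom d)) :=
      (ConcreteCategory.isIso_iff_bijective _).2 hbij
    exact ((MorphismProperty.isomorphisms Scheme).arrow_mk_iso_iff
      (SpecMapRestrictBasicOpenIso f d)).2 (inferInstanceAs (IsIso _))
  have hU : (⊥ : PrimeSpectrum P) ∈ PrimeSpectrum.basicOpen d := by
    change d ∉ (⊥ : Ideal P)
    simpa using hd
  have hV : (⊥ : PrimeSpectrum Q) ∈ PrimeSpectrum.basicOpen (φ d) := by
    change φ d ∉ (⊥ : Ideal Q)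
    simpa [map_eq_zero_iff φ hφ] using hd
  refine ⟨⟨Spec.map f ⁻¹ᵁ U, ?_, U, ?_, asIso (Spec.map f ∣_ U)⟩, ?_⟩
  · exact (Spec.map f ⁻¹ᵁ U).isOpen.dense ⟨_, hV⟩
  · exact U.isOpen.dense ⟨_, hU⟩
  · have : CommRingCat.ofHom (algebraMap K Q) = CommRingCat.ofHom (algebraMap K P) ≫ f := by
      ext x; exact (φ.commutes x).symm
    simp only [Scheme.PartialIso.IsOver, asIso_hom, this, Spec.map_comp]
    rw [morphismRestrict_ι_assoc]

/-- Integral affine schemes of finite type over a field with the same function field are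
birational. -/
theorem birationalOver_of_common_fractions {K P Q L : Type u} [Field K] [CommRing P] [CommRing Q]
    [IsDomain P] [IsDomain Q] [Algebra K P] [Algebra K Q] [Algebra.FiniteType K P]
    [Algebra.FiniteType K Q] [Field L] [Algebra K L] (p : P →ₐ[K] L) (q : Q →ₐ[K] L)
    (hp : Function.Injective p) (hq : Function.Injective q)
    (hpL : ∀ z, IsFractionOf p z) (hqL : ∀ z, IsFractionOf q z) :
    Scheme.BirationalOver (Spec.map (CommRingCat.ofHom (algebraMap K Q)))
      (Spec.map (CommRingCat.ofHom (algebraMap K P))) := by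
  -- The compositum of both images is again of finite type, and its spectrum maps birationally to
  -- both schemes.
  let M : Subalgebra K L := p.range ⊔ q.range
  have hM : Algebra.FiniteType K M := by
    refine Subalgebra.fg_iff_finiteType _ |>.1 (Subalgebra.FG.sup ?_ ?_)
    · exact (Subalgebra.fg_iff_finiteType _).2
        (Algebra.FiniteType.of_surjective p.rangeRestrict p.rangeRestrict_surjective)
    · exact (Subalgebra.fg_iff_finiteType _).2
        (Algebra.FiniteType.of_surjective q.rangeRestrict q.rangeRestrict_surjective)
  let pM : P →ₐ[K] M := p.codRestrict M fun x => (le_sup_left : p.range ≤ M) ⟨x, rfl⟩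
  let qM : Q →ₐ[K] M := q.codRestrict M fun x => (le_sup_right : q.range ≤ M) ⟨x, rfl⟩
  have h1 := birationalOver_of_fractions pM
    (fun x y hxy => hp (congrArg Subtype.val hxy)) fun m => by
      obtain ⟨d, hd, n, h⟩ := hpL m
      exact ⟨d, hd, n, Subtype.ext h⟩
  have h2 := birationalOver_of_fractions qM
    (fun x y hxy => hq (congrArg Subtype.val hxy)) fun m => by
      obtain ⟨d, hd, n, h⟩ := hqL m
      exact ⟨d, hd, n, Subtype.ext h⟩
  exact h2.symm.trans h1

theorem birationalOver_of_iso {S X Y : Scheme.{u}} {sX : X ⟶ S} {sY : Y ⟶ S} (e : X ≅ Y)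
    (h : e.hom ≫ sY = sX) : Scheme.BirationalOver sX sY := by
  refine ⟨.ofIso e, ?_⟩
  subst h
  change (X.topIso ≪≫ e ≪≫ Y.topIso.symm).hom ≫ (⊤ : Y.Opens).ι ≫ sY =
    (⊤ : X.Opens).ι ≫ e.hom ≫ sY
  have : Y.topIso.inv ≫ (⊤ : Y.Opens).ι = 𝟙 Y := Y.topIso.inv_hom_id
  simp only [Iso.trans_hom, Iso.symm_hom, Category.assoc, reassoc_of% this]
  rfl

theorem birationalOver_of_algEquiv {K P Q : Type u} [Field K] [CommRing P] [CommRing Q]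
    [Algebra K P] [Algebra K Q] (e : P ≃ₐ[K] Q) :
    Scheme.BirationalOver (Spec.map (CommRingCat.ofHom (algebraMap K Q)))
      (Spec.map (CommRingCat.ofHom (algebraMap K P))) := by
  refine birationalOver_of_iso (Scheme.Spec.mapIso e.toRingEquiv.toCommRingCatIso.op) ?_
  have : CommRingCat.ofHom (algebraMap K Q) =
      CommRingCat.ofHom (algebraMap K P) ≫ e.toRingEquiv.toCommRingCatIso.hom := by
    ext x; exact (e.commutes x).symm
  rw [this, Spec.map_comp]
  rfl

theorem isRationalOver_Spec_mvPolynomial (K : Type u) [Field K] (σ : Type u) :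
    Scheme.IsRationalOver
      (Spec.map (CommRingCat.ofHom (algebraMap K (MvPolynomial σ K)))) :=
  ⟨σ, birationalOver_of_iso (AffineSpace.SpecIso σ (CommRingCat.of K)).symm
    (AffineSpace.SpecIso_inv_over (CommRingCat.of K))⟩

end Birational

/-! ### Products of the matrices D(c) and the Pell matrices -/

section Matrices

variable {G : Type*} [CommRing G]

theorem t_mul_t : t G * t G = 1 := by
  simp [t, Matrix.one_fin_two]

/-- The product `D(c₁) ⋯ D(c_n)`. -/
def prodD {n : ℕ} (c : Fin n → G) : Matrix (Fin 2) (Fin 2) G :=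
  (List.ofFn fun i => D (c i)).prod

/-- The inverse of `D(c₁) ⋯ D(c_n)`. -/
def prodDInv {n : ℕ} (c : Fin n → G) : Matrix (Fin 2) (Fin 2) G :=
  t G * (List.ofFn fun i => D (-c (Fin.rev i))).prod * t G

theorem prodD_zero (c : Fin 0 → G) : prodD c = 1 := by simp [prodD]

theorem prodDInv_zero (c : Fin 0 → G) : prodDInv c = 1 := by simp [prodDInv, t_mul_t]

theorem prodD_succ {n : ℕ} (c : Fin (n + 1) → G) :
    prodD c = D (c 0) * prodD fun i => c i.succ := by
  simp [prodD]

theorem prodDInv_succ {n : ℕ} (c : Fin (n + 1) → G) :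
    prodDInv c = prodDInv (fun i => c i.succ) * !![0, 1; 1, -c 0] := by
  have h : !![0, 1; 1, -c 0] = t G * (D (-c 0) * t G) := by simp [t, D]
  rw [h, prodDInv, prodDInv, List.ofFn_succ_last]
  simp only [Fin.rev_castSucc, Fin.rev_last, List.prod_append, List.prod_singleton,
    Matrix.mul_assoc]
  rw [← Matrix.mul_assoc (t G) (t G), t_mul_t, Matrix.one_mul]

theorem prodD_mul_prodDInv {n : ℕ} (c : Fin n → G) : prodD c * prodDInv c = 1 := by
  induction n with
  | zero => simp [prodD_zero, prodDInv_zero]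
  | succ n ih =>
    rw [prodD_succ, prodDInv_succ, Matrix.mul_assoc, ← Matrix.mul_assoc (prodD _), ih,
      Matrix.one_mul]
    simp [D, Matrix.one_fin_two]

theorem prodDInv_mul_prodD {n : ℕ} (c : Fin n → G) : prodDInv c * prodD c = 1 :=
  mul_eq_one_comm.1 (prodD_mul_prodDInv c)

theorem det_prodD {n : ℕ} (c : Fin n → G) : (prodD c).det = (-1) ^ n := by
  induction n with
  | zero => simp [prodD_zero]
  | succ n ih => rw [prodD_succ, Matrix.det_mul, ih]; simp [D, pow_succ']

theorem det_prodDInv {n : ℕ} (c : Fin n → G) : (prodDInv c).det = (-1) ^ n := by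
  induction n with
  | zero => simp [prodDInv_zero]
  | succ n ih => rw [prodDInv_succ, Matrix.det_mul, ih]; simp [pow_succ]

theorem matE_eq {N k : ℕ} (b : Fin N → G) (a : Fin k → G) :
    matE b a = prodD b * prodD a * prodDInv b := by
  simp [matE, prodD, prodDInv, Matrix.mul_assoc]

theorem det_matE {N k : ℕ} (b : Fin N → G) (a : Fin k → G) : (matE b a).det = (-1) ^ k := by
  rw [matE_eq, Matrix.det_mul, Matrix.det_mul, det_prodD, det_prodD, det_prodDInv,
    mul_right_comm, ← pow_add, Even.neg_one_pow ⟨N, rfl⟩, one_mul]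

variable {H : Type*} [CommRing H] (φ : G →+* H)

theorem map_D (x : G) : φ.mapMatrix (D x) = D (φ x) := by
  ext i j; fin_cases i <;> fin_cases j <;> simp [D]

theorem map_t : φ.mapMatrix (t G) = t H := by
  ext i j; fin_cases i <;> fin_cases j <;> simp [t]

theorem map_prodD {n : ℕ} (c : Fin n → G) : φ.mapMatrix (prodD c) = prodD (φ ∘ c) := by
  simp only [prodD, map_list_prod, List.map_ofFn, Function.comp_def, map_D]

theorem map_prodDInv {n : ℕ} (c : Fin n → G) : φ.mapMatrix (prodDInv c) = prodDInv (φ ∘ c) := by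
  simp only [prodDInv, map_mul, map_list_prod, List.map_ofFn, Function.comp_def, map_D, map_t,
    map_neg]

theorem map_matE {N k : ℕ} (b : Fin N → G) (a : Fin k → G) :
    φ.mapMatrix (matE b a) = matE (φ ∘ b) (φ ∘ a) := by
  simp only [matE_eq, map_mul, map_prodD, map_prodDInv]

/-- A matrix of determinant `-1` is a product `D(a₀) D(a₁) D(a₂)` as soon as `a₀` solves the linear
equation for the upper right entry. -/
theorem D_mul_D_mul_D_eq {P : Matrix (Fin 2) (Fin 2) G} (hP : P.det = -1) {a : G}
    (ha : P 1 1 * a = P 0 1 - 1) :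
    D a * (D (P 1 1) * D (P 0 0 - a * P 1 0)) = P := by
  rw [Matrix.det_fin_two] at hP
  ext i j
  fin_cases i <;> fin_cases j <;>
    simp only [D, Matrix.mul_apply, Fin.sum_univ_two, Fin.zero_eta, Fin.mk_one, Matrix.of_apply,
      Matrix.cons_val', Matrix.cons_val_zero, Matrix.cons_val_one, Matrix.cons_val_fin_one]
  · linear_combination a * hP - a * P 1 0 * ha
  · linear_combination ha
  · linear_combination hP - P 1 0 * ha
  · ring

theorem D_mul_D_mul_D (a₀ a₁ a₂ : G) :
    D a₀ * (D a₁ * D a₂) = !![a₀ * (a₁ * a₂ + 1) + a₂, a₀ * a₁ + 1; a₁ * a₂ + 1, a₁] := by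
  simp [D]

/-- The matrix `[[x, -C y], [A y, x + B y]]`. -/
def pellMatrix (A B C x y : G) : Matrix (Fin 2) (Fin 2) G :=
  !![x, -C * y; A * y, x + B * y]

theorem det_pellMatrix (A B C x y : G) :
    (pellMatrix A B C x y).det = x ^ 2 + B * x * y + A * C * y ^ 2 := by
  simp only [pellMatrix, Matrix.det_fin_two_of]; ring

theorem map_pellMatrix (A B C x y : G) :
    φ.mapMatrix (pellMatrix A B C x y) = pellMatrix (φ A) (φ B) (φ C) (φ x) (φ y) := by
  ext i j; fin_cases i <;> fin_cases j <;> simp [pellMatrix]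

/-- The vector (M₁₀, M₁₁ - M₀₀, -M₀₁) has vanishing 2×2 minors with the unimodular vector (A, B, C).
Over any commutative ring it is then a multiple of (A, B, C), and pairing with (α, β, γ) gives the
factor y. -/
theorem eq_pellMatrix {A B C α β γ : G} (h : α * A + β * B + γ * C = 1)
    {M : Matrix (Fin 2) (Fin 2) G} (h1 : B * M 1 0 = A * (M 1 1 - M 0 0))
    (h2 : -A * M 0 1 = C * M 1 0) (h3 : -B * M 0 1 = C * (M 1 1 - M 0 0)) :
    M = pellMatrix A B C (M 0 0) (α * M 1 0 + β * (M 1 1 - M 0 0) - γ * M 0 1) := by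
  ext i j
  fin_cases i <;> fin_cases j <;>
    simp only [pellMatrix, Fin.zero_eta, Fin.mk_one, Matrix.of_apply,
      Matrix.cons_val', Matrix.cons_val_zero, Matrix.cons_val_one, Matrix.cons_val_fin_one]
  · linear_combination (-M 0 1) * h - α * h2 - β * h3
  · linear_combination (-M 1 0) * h + β * h1 - γ * h2
  · linear_combination (-(M 1 1 - M 0 0)) * h - α * h1 - γ * h3

/-- D(0) = t, and conjugation by t exchanges the two diagonal entries. -/
theorem prodDInv_conj_prodD_zero (M : Matrix (Fin 2) (Fin 2) G) (N : ℕ) :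
    (prodDInv (fun _ : Fin N => (0 : G)) * M * prodD (fun _ : Fin N => (0 : G)) :
      Matrix (Fin 2) (Fin 2) G) 1 1 = M 1 1 ∨
    (prodDInv (fun _ : Fin N => (0 : G)) * M * prodD (fun _ : Fin N => (0 : G)) :
      Matrix (Fin 2) (Fin 2) G) 1 1 = M 0 0 := by
  induction N generalizing M with
  | zero => left; simp [prodD_zero, prodDInv_zero]
  | succ N ih =>
    have key : prodDInv (fun _ : Fin (N + 1) => (0 : G)) * M * prodD (fun _ : Fin (N + 1) => 0) =
        prodDInv (fun _ : Fin N => (0 : G)) * (t G * M * t G) * prodD (fun _ : Fin N => 0) := by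
      rw [prodD_succ, prodDInv_succ]
      simp [D, t, Matrix.mul_assoc]
    rw [key]
    have e1 : (t G * M * t G) 1 1 = M 0 0 := by simp [t, Matrix.mul_apply, Matrix.vecMul, dotProduct]
    have e2 : (t G * M * t G) 0 0 = M 1 1 := by simp [t, Matrix.mul_apply, Matrix.vecMul, dotProduct]
    have := ih (t G * M * t G)
    rw [e1, e2] at this
    exact this.symm

/-- Multiplying by `(D(c₁) ⋯ D(c_n))⁻¹` on the right, one can move the lower right entry away from
`0` and, if `n ≥ 1`, also away from `1`. -/
theorem exists_mul_prodDInv_apply_ne [IsDomain G] [Infinite G] {M : Matrix (Fin 2) (Fin 2) G}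
    (hM : M 1 1 ≠ 0) (n : ℕ) :
    ∃ c : Fin n → G, (M * prodDInv c) 1 1 ≠ 0 ∧ (n ≠ 0 → (M * prodDInv c) 1 1 ≠ 1) := by
  induction n with
  | zero => exact ⟨fun i => i.elim0, by simpa [prodDInv_zero] using hM, by simp⟩
  | succ n ih =>
    obtain ⟨c, hc, -⟩ := ih
    set Q := M * prodDInv c with hQ
    -- One more factor turns the entry into a nonconstant affine function of the new variable z, so
    -- an infinite domain has a value of z avoiding both 0 and 1.
    have hinj : Function.Injective fun z => Q 1 0 - Q 1 1 * z := fun z w hzw => by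
      have : Q 1 1 * (w - z) = 0 := by linear_combination hzw
      rcases mul_eq_zero.1 this with h | h
      · exact absurd h hc
      · exact (sub_eq_zero.1 h).symm
    obtain ⟨z, hz⟩ : ∃ z, Q 1 0 - Q 1 1 * z ∉ ({0, 1} : Set G) := by
      by_contra! h
      refine Set.infinite_range_of_injective hinj ((Set.toFinite {0, 1}).subset ?_)
      rintro _ ⟨z, rfl⟩
      exact h z
    have key : (M * prodDInv (Fin.cons z c : Fin (n + 1) → G)) 1 1 = Q 1 0 - Q 1 1 * z := by
      rw [prodDInv_succ, ← Matrix.mul_assoc]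
      simp only [Fin.cons_zero, Fin.cons_succ]
      change (Q * !![0, 1; 1, -z]) 1 1 = _
      simp [Matrix.mul_apply, Fin.sum_univ_two, sub_eq_add_neg]
    refine ⟨Fin.cons z c, ?_, fun _ => ?_⟩ <;> rw [key] <;> intro h <;> exact hz (by simp [h])

end Matrices

/-! ### The hypersurface pX = r for a regular sequence p, r -/

section LinearPolynomial

open Polynomial

variable {T : Type*} [CommRing T] [IsDomain T] {L : Type*} [Field L] [Algebra T L]
  [IsFractionRing T L]

/-- If `p, r` is a regular sequence in a domain `T`, then `p X - r` generates the kernel of the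
evaluation map `T[X] → Frac T` at `r / p`. -/
theorem dvd_of_aeval_div_eq_zero {p r : T} (hp : p ≠ 0) (hpr : ∀ z, p ∣ z * r → p ∣ z) (f : T[X])
    (hf : aeval (algebraMap T L r / algebraMap T L p) f = 0) : C p * X - C r ∣ f := by
  have hpL : algebraMap T L p ≠ 0 := by
    simpa [map_eq_zero_iff _ (IsFractionRing.injective T L)] using hp
  have hpow : ∀ n z, p ∣ z * r ^ n → p ∣ z := by
    intro n
    induction n with
    | zero => simp
    | succ n ih => exact fun z h => ih z (hpr _ (by rwa [mul_assoc, ← pow_succ]))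
  induction hn : f.natDegree using Nat.strong_induction_on generalizing f with
  | _ n ih =>
  by_cases hf0 : f = 0
  · simp [hf0]
  rcases Nat.eq_zero_or_pos n with h0 | h0
  · obtain ⟨c, rfl⟩ := natDegree_eq_zero.1 (hn.trans h0)
    rw [aeval_C, map_eq_zero_iff _ (IsFractionRing.injective T L)] at hf
    exact absurd (by simp [hf]) hf0
  -- Clearing denominators in f(r/p) = 0 shows that p divides the leading coefficient times rⁿ;
  -- regularity removes rⁿ.
  have hlead : p ∣ f.leadingCoeff := by
    apply hpow n
    have h1 : ∑ i ∈ Finset.range (n + 1), f.coeff i * r ^ i * p ^ (n - i) = 0 := by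
      apply IsFractionRing.injective T L
      rw [map_zero, ← mul_zero (algebraMap T L p ^ n), ← hf, aeval_eq_sum_range, hn, map_sum,
        Finset.mul_sum]
      refine Finset.sum_congr rfl fun i hi => ?_
      have hi' : i ≤ n := Nat.lt_succ_iff.1 (Finset.mem_range.1 hi)
      rw [Algebra.smul_def, map_mul, map_mul, map_pow, map_pow, div_pow]
      conv_rhs => rw [← Nat.sub_add_cancel hi', pow_add]
      field_simp
    rw [Finset.sum_range_succ, Nat.sub_self, pow_zero, mul_one, add_comm] at h1
    rw [leadingCoeff, hn, eq_neg_of_add_eq_zero_left h1, dvd_neg]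
    refine Finset.dvd_sum fun i hi => Dvd.dvd.mul_left (dvd_pow_self p ?_) _
    have := Finset.mem_range.1 hi
    omega
  obtain ⟨c, hc⟩ := hlead
  have hc0 : c ≠ 0 := by rintro rfl; simp [hf0] at hc
  -- This multiple of pX - r has the leading term of f, so subtracting it lowers the degree.
  set q : T[X] := C c * X ^ (n - 1) * (C p * X - C r) with hq
  have hqdvd : C p * X - C r ∣ q := dvd_mul_left _ _
  have hlin : (C p * X - C r).leadingCoeff = p := by
    rw [sub_eq_add_neg, ← C_neg]; exact leadingCoeff_linear hp
  have hlin' : (C p * X - C r).natDegree = 1 := by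
    rw [sub_eq_add_neg, ← C_neg]; exact natDegree_linear hp
  have hlin0 : C p * X - C r ≠ 0 := by
    intro h; rw [h] at hlin'; simp at hlin'
  have hqlead : q.leadingCoeff = f.leadingCoeff := by
    rw [hq, leadingCoeff_mul, hlin, leadingCoeff_C_mul_X_pow, hc, mul_comm]
  have hqdeg : q.natDegree = n := by
    rw [hq, natDegree_mul (by simpa using hc0) hlin0, hlin', natDegree_C_mul_X_pow _ _ hc0]
    omega
  have hq0 : q ≠ 0 := by
    intro h; rw [h] at hqdeg; simp at hqdeg; omega
  have hqe : aeval (algebraMap T L r / algebraMap T L p) q = 0 := by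
    rw [hq, map_mul]
    simp [mul_div_cancel₀ _ hpL]
  have hlt : (f - q).natDegree < n := by
    have hd : (f - q).degree < f.degree :=
      degree_sub_lt_left (by rw [degree_eq_natDegree hf0, degree_eq_natDegree hq0, hn, hqdeg]) hf0
        hqlead.symm
    by_cases h : f - q = 0
    · simpa [h] using h0
    · rw [← hn]; exact natDegree_lt_natDegree h hd
  have := ih _ hlt (f - q) (by rw [map_sub, hf, hqe, sub_zero]) rfl
  simpa using dvd_add this hqdvd

theorem dvd_iff_aeval_div_eq_zero {p r : T} (hp : p ≠ 0) (hpr : ∀ z, p ∣ z * r → p ∣ z) (f : T[X]) :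
    C p * X - C r ∣ f ↔ aeval (algebraMap T L r / algebraMap T L p) f = 0 := by
  refine ⟨?_, dvd_of_aeval_div_eq_zero hp hpr f⟩
  rintro ⟨g, rfl⟩
  have hpL : algebraMap T L p ≠ 0 := by
    simpa [map_eq_zero_iff _ (IsFractionRing.injective T L)] using hp
  simp [mul_div_cancel₀ _ hpL]

/-- For `u q - s v = 1` with `q ≠ 0, 1`, the linear polynomials `s - q Y` and `u - v Y - 1` form a
regular sequence. -/
theorem linear_dvd_of_dvd_mul {T : Type*} [CommRing T] [IsDomain T] {u v s q : T}
    (hdet : u * q - v * s = 1) (hq0 : q ≠ 0) (hq1 : q ≠ 1) (z : T[X])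
    (hz : C s - C q * X ∣ z * (C u - C v * X - 1)) : C s - C q * X ∣ z := by
  -- The determinant relation makes q and s comaximal: w = q(wu) - v(ws).
  have hqs : ∀ w, q ∣ w * s → q ∣ w := by
    rintro w ⟨g, hg⟩
    exact ⟨w * u - v * g, by linear_combination (-w) * hdet - v * hg⟩
  have hneg : C s - C q * X = -(C q * X - C s) := by ring
  rw [hneg, neg_dvd] at hz ⊢
  rw [dvd_iff_aeval_div_eq_zero (L := FractionRing T) hq0 hqs] at hz ⊢
  have hinj := IsFractionRing.injective T (FractionRing T)
  have hqL : algebraMap T (FractionRing T) q ≠ 0 := by simpa [map_eq_zero_iff _ hinj] using hq0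
  rw [map_mul, mul_eq_zero] at hz
  -- At Y = s/q the second polynomial takes the value (uq - vs)/q - 1 = 1/q - 1, which vanishes only
  -- for q = 1.
  refine hz.resolve_right fun h => hq1 (hinj ?_)
  have hdetL := congrArg (algebraMap T (FractionRing T)) hdet
  simp only [map_sub, map_mul, map_one, aeval_C, aeval_X] at h hdetL ⊢
  field_simp at h
  linear_combination hdetL - h

end LinearPolynomial

/-! ### The affine conic and its parametrization -/

section Conic

open Polynomial

variable {K : Type u} [Field K]

/-- The polynomial `X² + β Y X + δ Y² - ε` in `X` over `K[Y]`. -/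
noncomputable def conicPoly (β δ ε : K) : K[X][X] :=
  X ^ 2 + C (C β * X) * X + C (C δ * X ^ 2 - C ε)

/-- The coordinate ring of the affine conic `x² + β x y + δ y² = ε`. -/
abbrev ConicRing (β δ ε : K) : Type u := AdjoinRoot (conicPoly β δ ε)

theorem natDegree_conicPoly (β δ ε : K) : (conicPoly β δ ε).natDegree = 2 := by
  have : conicPoly β δ ε = C 1 * X ^ 2 + C (C β * X) * X + C (C δ * X ^ 2 - C ε) := by
    simp [conicPoly]
  rw [this, natDegree_quadratic one_ne_zero]

theorem monic_conicPoly (β δ ε : K) : (conicPoly β δ ε).Monic := by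
  have : conicPoly β δ ε = C 1 * X ^ 2 + C (C β * X) * X + C (C δ * X ^ 2 - C ε) := by
    simp [conicPoly]
  rw [this, Monic, leadingCoeff_quadratic one_ne_zero]

/-- A factorization would make the discriminant (β² - 4δ)Y² + 4ε in X the square of a linear
polynomial aY + b. Comparing values at 0 and ±1 gives ab = 0, hence β² = 4δ or ε = 0. -/
theorem irreducible_conicPoly [CharZero K] {β δ ε : K} (hΔ : β ^ 2 - 4 * δ ≠ 0) (hε : ε ≠ 0) :
    Irreducible (conicPoly β δ ε) := by
  by_contra h
  obtain ⟨c₁, c₂, h0, h1⟩ := ((monic_conicPoly β δ ε).not_irreducible_iff_exists_add_mul_eq_coeff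
    (natDegree_conicPoly β δ ε)).1 h
  have h0' : C δ * X ^ 2 - C ε = c₁ * c₂ := by
    rw [← h0]; simp [conicPoly, coeff_X, coeff_C, coeff_X_pow, -map_sub, -map_mul, -map_pow]
  have h1' : C β * X = c₁ + c₂ := by
    rw [← h1]; simp [conicPoly, coeff_C, coeff_X_pow, -map_sub, -map_mul, -map_pow]
  have hsq : (c₁ - c₂) ^ 2 = C (β ^ 2 - 4 * δ) * X ^ 2 + C 0 * X + C (4 * ε) := by
    simp only [C_sub, C_mul, C_pow, C_0, zero_mul, add_zero,
      show (C (4 : K) : K[X]) = 4 from rfl]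
    linear_combination 4 * h0' - (C β * X + c₁ + c₂) * h1'
  have hdeg : (c₁ - c₂).natDegree = 1 := by
    have := congrArg natDegree hsq
    rw [natDegree_pow, natDegree_quadratic hΔ] at this
    omega
  obtain ⟨a, b, hab⟩ := exists_eq_X_add_C_of_natDegree_le_one hdeg.le
  rw [hab] at hsq
  have e0 := congrArg (eval 0) hsq
  have e1 := congrArg (eval 1) hsq
  have e2 := congrArg (eval (-1)) hsq
  simp only [eval_add, eval_mul, eval_pow, eval_C, eval_X] at e0 e1 e2
  have hab0 : a * b = 0 := by
    have : 4 * (a * b) = 0 := by linear_combination e1 - e2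
    simpa using this
  rcases mul_eq_zero.1 hab0 with h | h
  · exact hΔ (by subst h; linear_combination e0 - e1)
  · exact hε (by subst h; have : 4 * ε = 0 := by linear_combination -e0
                 simpa using this)

theorem isDomain_conicRing [CharZero K] {β δ ε : K} (hΔ : β ^ 2 - 4 * δ ≠ 0) (hε : ε ≠ 0) :
    IsDomain (ConicRing β δ ε) :=
  AdjoinRoot.isDomain_of_prime (irreducible_conicPoly hΔ hε).prime

namespace ConicRing

variable (β δ ε : K)

/-- The coordinate function `x`. -/
noncomputable def x : ConicRing β δ ε := AdjoinRoot.root _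

/-- The coordinate function `y`. -/
noncomputable def y : ConicRing β δ ε := AdjoinRoot.of _ X

theorem equation : x β δ ε ^ 2 + algebraMap K _ β * x β δ ε * y β δ ε +
    algebraMap K _ δ * y β δ ε ^ 2 = algebraMap K _ ε := by
  have h := AdjoinRoot.eval₂_root (conicPoly β δ ε)
  conv at h => enter [1, 3]; rw [conicPoly]
  simp only [eval₂_add, eval₂_mul, eval₂_pow, eval₂_X, eval₂_C] at h
  simp only [map_sub, map_mul, map_pow] at h
  change _ ^ 2 + AdjoinRoot.of _ (C β) * _ * _ + AdjoinRoot.of _ (C δ) * _ ^ 2 =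
    AdjoinRoot.of _ (C ε)
  rw [x, y]
  linear_combination h

theorem x_ne_zero : x β δ ε ≠ 0 := by
  have : x β δ ε = AdjoinRoot.mk (conicPoly β δ ε) X := (AdjoinRoot.mk_X).symm
  rw [this]
  refine AdjoinRoot.mk_ne_zero_of_natDegree_lt (monic_conicPoly β δ ε) X_ne_zero ?_
  rw [natDegree_conicPoly]; simp

theorem x_add_mul_y_ne_zero (c : K) : x β δ ε + algebraMap K _ c * y β δ ε ≠ 0 := by
  have : x β δ ε + algebraMap K _ c * y β δ ε =
      AdjoinRoot.mk (conicPoly β δ ε) (X + C (C c * X)) := by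
    rw [map_add, AdjoinRoot.mk_X, AdjoinRoot.mk_C, map_mul]; rfl
  rw [this]
  refine AdjoinRoot.mk_ne_zero_of_natDegree_lt (monic_conicPoly β δ ε) (X_add_C_ne_zero _) ?_
  rw [natDegree_conicPoly, natDegree_X_add_C]; simp

variable {β δ ε} {G : Type*} [CommRing G] [Algebra K G]

/-- The homomorphism defined by a point of the conic. -/
noncomputable def lift (u v : G)
    (h : u ^ 2 + algebraMap K G β * u * v + algebraMap K G δ * v ^ 2 = algebraMap K G ε) :
    ConicRing β δ ε →ₐ[K] G :=
  AdjoinRoot.liftAlgHom _ (aeval v) u (by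
    simp only [conicPoly, eval₂_add, eval₂_mul, eval₂_pow, eval₂_X, eval₂_C]
    simp only [map_sub, map_mul, map_pow, RingHom.coe_coe, aeval_C, aeval_X]
    linear_combination h)

@[simp] theorem lift_x (u v : G) (h) : lift (β := β) (δ := δ) (ε := ε) u v h (x β δ ε) = u := by
  simp [lift, x]

@[simp] theorem lift_y (u v : G) (h) : lift (β := β) (δ := δ) (ε := ε) u v h (y β δ ε) = v := by
  simp [lift, y]

theorem algHom_ext {f g : ConicRing β δ ε →ₐ[K] G} (hx : f (x β δ ε) = g (x β δ ε))
    (hy : f (y β δ ε) = g (y β δ ε)) : f = g := by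
  apply AdjoinRoot.algHom_ext'
  · apply Polynomial.algHom_ext
    exact hy
  · exact hx

end ConicRing

/-- If a domain maps injectively to `K(t)` and `t` is a fraction of elements of the image, then
so is every element of `K(t)`. -/
theorem isFractionOf_of_X_eq_div {R : Type*} [CommRing R] [IsDomain R] [Algebra K R]
    (φ : R →ₐ[K] RatFunc K) (hφ : Function.Injective φ) {a b : R}
    (hX : RatFunc.X = φ a / φ b) (z : RatFunc K) : IsFractionOf φ z := by
  let ψ : FractionRing R →ₐ[K] RatFunc K := IsFractionRing.liftAlgHom hφ
  have hψ : ∀ r, ψ (algebraMap R _ r) = φ r := fun r => by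
    simp [ψ, IsFractionRing.liftAlgHom_apply, IsFractionRing.lift_algebraMap]
  -- The image of the fraction field is a subfield containing K; once it contains t it is all of
  -- K(t).
  have hXmem : RatFunc.X ∈ ψ.fieldRange :=
    ⟨algebraMap R _ a / algebraMap R _ b, by simp [hψ, hX]⟩
  have hpoly : ∀ p : K[X], algebraMap K[X] (RatFunc K) p ∈ ψ.fieldRange := fun p => by
    have : algebraMap K[X] (RatFunc K) p = aeval RatFunc.X p := by
      rw [← RatFunc.algebraMap_X, aeval_algebraMap_apply, aeval_X_left_apply]
    rw [this]
    exact Algebra.adjoin_le (S := ψ.fieldRange.toSubalgebra) (by simpa using hXmem)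
      (aeval_mem_adjoin_singleton K _)
  obtain ⟨p, q, hq, rfl⟩ := IsFractionRing.div_surjective (A := K[X]) z
  obtain ⟨w, hw⟩ := div_mem (hpoly p) (hpoly q)
  obtain ⟨a, b, hb, rfl⟩ := IsFractionRing.div_surjective (A := R) w
  have : algebraMap K[X] (RatFunc K) p / algebraMap K[X] (RatFunc K) q = φ a / φ b := by
    rw [← hw, ← hψ a, ← hψ b]; exact map_div₀ ψ _ _
  rw [this]
  exact .of_div a b

/-- A conic with a rational point is parametrized by the lines through this point. -/
theorem ConicRing.exists_parametrization [CharZero K] {β δ ε : K} (hΔ : β ^ 2 - 4 * δ ≠ 0)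
    (hε : ε ≠ 0) {x₀ y₀ : K} (h₀ : x₀ ^ 2 + β * x₀ * y₀ + δ * y₀ ^ 2 = ε) :
    ∃ φ : ConicRing β δ ε →ₐ[K] RatFunc K, Function.Injective φ ∧
      ∀ z, IsFractionOf φ z := by
  have := isDomain_conicRing hΔ hε
  -- Substituting the line (x₀ + s, y₀ + st) into the conic gives s(s n(t) + l(t)) = 0, so the
  -- second intersection point has s = -l/n.
  let n : K[X] := 1 + C β * X + C δ * X ^ 2
  let l : K[X] := C (2 * x₀ + β * y₀) + C (β * x₀ + 2 * δ * y₀) * X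
  let ι := algebraMap K[X] (RatFunc K)
  have hι : Function.Injective ι := IsFractionRing.injective _ _
  have hιC : ∀ c : K, ι (C c) = algebraMap K (RatFunc K) c := fun c =>
    (IsScalarTower.algebraMap_apply K K[X] (RatFunc K) c).symm
  have hιX : ι X = RatFunc.X := RatFunc.algebraMap_X
  have hn : ι n ≠ 0 := by
    rw [Ne, map_eq_zero_iff ι hι]
    intro h
    simpa [n] using congrArg (eval 0) h
  -- The coefficients of l are the partial derivatives of the quadratic form at (x₀, y₀); both
  -- vanish only at the origin, which is not on the conic.
  have hl : l ≠ 0 := by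
    intro h
    have e0 := congrArg (eval 0) h
    have e1 := congrArg (eval 1) h
    simp only [l, eval_add, eval_mul, eval_C, eval_X, eval_zero] at e0 e1
    have hx : (β ^ 2 - 4 * δ) * x₀ = 0 := by
      linear_combination β * (e1 - e0) - 2 * δ * e0
    have hy : (β ^ 2 - 4 * δ) * y₀ = 0 := by
      linear_combination β * e0 - 2 * (e1 - e0)
    have hx0 := (mul_eq_zero.1 hx).resolve_left hΔ
    have hy0 := (mul_eq_zero.1 hy).resolve_left hΔ
    exact hε (by rw [← h₀, hx0, hy0]; ring)
  have hlι : ι l ≠ 0 := by rwa [Ne, map_eq_zero_iff ι hι]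
  let s : RatFunc K := -ι l / ι n
  have hs : s ≠ 0 := div_ne_zero (neg_ne_zero.2 hlι) hn
  have hrel : s * ι n + ι l = 0 := by simp only [s]; field_simp; ring
  have hnι : ι n = 1 + algebraMap K _ β * RatFunc.X + algebraMap K _ δ * RatFunc.X ^ 2 := by
    simp only [n, map_add, map_mul, map_pow, map_one, hιC, hιX]
  have hlι' : ι l = 2 * algebraMap K _ x₀ + algebraMap K _ β * algebraMap K _ y₀ +
      (algebraMap K _ β * algebraMap K _ x₀ + 2 * algebraMap K _ δ * algebraMap K _ y₀) *
        RatFunc.X := by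
    simp only [l, map_add, map_mul, hιC, hιX, map_ofNat]
  have h₀' := congrArg (algebraMap K (RatFunc K)) h₀
  simp only [map_add, map_mul, map_pow] at h₀'
  let v : RatFunc K := algebraMap K _ y₀ + s * RatFunc.X
  let φ : ConicRing β δ ε →ₐ[K] RatFunc K :=
    lift (algebraMap K _ x₀ + s) v (by
      rw [hnι, hlι'] at hrel
      linear_combination h₀' + s * hrel)
  have hφx : φ (x β δ ε) = algebraMap K _ x₀ + s := lift_x _ _ _
  have hφy : φ (y β δ ε) = v := lift_y _ _ _
  have hv : Transcendental K v := by
    apply RatFunc.transcendental_of_ne_C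
    rintro ⟨c, hc⟩
    have hc' : v = ι (C c) := hc
    have : ι (X * l) = ι ((C y₀ - C c) * n) := by
      rw [map_mul, map_mul, map_sub, ← hc', hιC, hιX]
      simp only [v]
      linear_combination RatFunc.X * hrel
    have hp := hι this
    have e0 := congrArg (eval 0) hp
    simp only [n, eval_mul, eval_add, eval_sub, eval_X, eval_C, eval_one, eval_pow] at e0
    have hc0 : y₀ - c = 0 := by linear_combination -e0
    rw [← C_sub, hc0] at hp
    simp [hl] at hp
  have hinj : Function.Injective φ := by
    rw [← AlgHom.coe_toRingHom, RingHom.injective_iff_ker_eq_bot]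
    -- The conic is finite over the y-line, so injectivity need only be checked on K[y], where it
    -- says that v is transcendental.
    have : Module.Finite K[X] (ConicRing β δ ε) := (monic_conicPoly β δ ε).finite_adjoinRoot
    apply Ideal.eq_bot_of_comap_eq_bot (R := K[X])
    rw [eq_bot_iff]
    intro p hp
    have h1 : φ (algebraMap K[X] _ p) = aeval v p := by
      have : (φ.comp (AdjoinRoot.ofAlgHom K (conicPoly β δ ε))) = aeval v :=
        Polynomial.algHom_ext (by rw [aeval_X]; exact hφy)
      exact congr($this p)
    have h2 : aeval v p = 0 := h1 ▸ hp
    exact transcendental_iff.1 hv p h2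
  -- The parameter is the slope (y - y₀)/(x - x₀).
  refine ⟨φ, hinj, isFractionOf_of_X_eq_div φ hinj
    (a := y β δ ε - algebraMap K _ y₀) (b := x β δ ε - algebraMap K _ x₀) ?_⟩
  rw [map_sub, map_sub, hφx, hφy, AlgHom.commutes, AlgHom.commutes]
  simp only [v, add_sub_cancel_left]
  field_simp

end Conic

/-! ### Isolating the first three factors -/

section HeadMatrix

variable {G : Type*} [CommRing G]

/-- If `M = D(b₁) ⋯ D(b_N) D(a₀) D(a₁) D(a₂) D(c₁) ⋯ D(c_n) (D(b₁) ⋯ D(b_N))⁻¹`, this is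
`D(a₀) D(a₁) D(a₂)`. -/
def headMatrix {N n : ℕ} (b : Fin N → G) (M : Matrix (Fin 2) (Fin 2) G) (c : Fin n → G) :
    Matrix (Fin 2) (Fin 2) G :=
  prodDInv b * M * prodD b * prodDInv c

theorem map_headMatrix {H : Type*} [CommRing H] (φ : G →+* H) {N n : ℕ} (b : Fin N → G)
    (M : Matrix (Fin 2) (Fin 2) G) (c : Fin n → G) :
    φ.mapMatrix (headMatrix b M c) = headMatrix (φ ∘ b) (φ.mapMatrix M) (φ ∘ c) := by
  simp only [headMatrix, map_mul, map_prodD, map_prodDInv]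

theorem det_headMatrix {N n : ℕ} (b : Fin N → G) (M : Matrix (Fin 2) (Fin 2) G) (c : Fin n → G) :
    (headMatrix b M c).det = M.det * (-1) ^ n := by
  have h : ((-1 : G) ^ N) * (-1) ^ N = 1 := by
    rw [← pow_add]; exact Even.neg_one_pow ⟨N, rfl⟩
  simp only [headMatrix, Matrix.det_mul, det_prodD, det_prodDInv]
  linear_combination M.det * (-1) ^ n * h

theorem headMatrix_succ {N n : ℕ} (b : Fin N → G) (M : Matrix (Fin 2) (Fin 2) G)
    (c : Fin (n + 1) → G) :
    headMatrix b M c = headMatrix b M (fun i => c i.succ) * !![0, 1; 1, -c 0] := by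
  rw [headMatrix, prodDInv_succ, ← Matrix.mul_assoc]; rfl

theorem headMatrix_matE {N n : ℕ} (b : Fin N → G) (a : Fin (n + 3) → G) :
    headMatrix b (matE b a) (fun i => a i.succ.succ.succ) =
      D (a 0) * (D (a 1) * D (a 2)) := by
  have h : prodD a = D (a 0) * (D (a 1) * D (a 2)) * prodD (fun i => a i.succ.succ.succ) := by
    rw [prodD_succ, prodD_succ, prodD_succ]
    simp only [Matrix.mul_assoc]
    rfl
  rw [headMatrix, matE_eq, h]
  simp only [← Matrix.mul_assoc, prodDInv_mul_prodD, Matrix.one_mul]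
  simp only [Matrix.mul_assoc, prodDInv_mul_prodD, Matrix.one_mul]
  rw [prodD_mul_prodDInv, Matrix.mul_one]

/-- Converse of `headMatrix_matE`: solving for the first three factors is equivalent to prescribing
`matE`. -/
theorem matE_cons_eq {N n : ℕ} (b : Fin N → G) (M : Matrix (Fin 2) (Fin 2) G) (c : Fin n → G)
    {a₀ a₁ a₂ : G} (h : D a₀ * (D a₁ * D a₂) = headMatrix b M c) :
    matE b (Fin.cons a₀ (Fin.cons a₁ (Fin.cons a₂ c : Fin (n + 1) → G) : Fin (n + 2) → G) :
      Fin (n + 3) → G) = M := by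
  have h' : prodD (Fin.cons a₀ (Fin.cons a₁ (Fin.cons a₂ c : Fin (n + 1) → G) : Fin (n + 2) → G) :
      Fin (n + 3) → G) = D a₀ * (D a₁ * D a₂) * prodD c := by
    rw [prodD_succ, prodD_succ, prodD_succ]
    simp only [Matrix.mul_assoc]
    rfl
  rw [matE_eq, h', h, headMatrix]
  simp only [Matrix.mul_assoc, prodDInv_mul_prodD, Matrix.mul_one]
  rw [prodD_mul_prodDInv, Matrix.mul_one, ← Matrix.mul_assoc, prodD_mul_prodDInv, Matrix.one_mul]

end HeadMatrix

/-! ### The coordinate ring of V and its universal property -/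

section CoordinateRing

variable {K : Type u} [Field K] (A B C : K) (N k : ℕ)

/-- The coordinate ring of `V(Q)_{N,k}`. -/
abbrev CoordRing : Type u := MvPolynomial (Fin N ⊕ Fin k) K ⧸ idealV A B C N k

/-- The condition that `M` is proportional to `Q = A x² + B x + C`, modulo scalar matrices. -/
def Proportional {G : Type*} [CommRing G] [Algebra K G] (M : Matrix (Fin 2) (Fin 2) G) : Prop :=
  algebraMap K G B * M 1 0 = algebraMap K G A * (M 1 1 - M 0 0) ∧
    -algebraMap K G A * M 0 1 = algebraMap K G C * M 1 0 ∧
    -algebraMap K G B * M 0 1 = algebraMap K G C * (M 1 1 - M 0 0)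

theorem proportional_pellMatrix {G : Type*} [CommRing G] [Algebra K G] (x y : G) :
    Proportional A B C
      (pellMatrix (algebraMap K G A) (algebraMap K G B) (algebraMap K G C) x y) := by
  refine ⟨?_, ?_, ?_⟩ <;> simp [pellMatrix] <;> ring

namespace CoordRing

/-- The coordinate functions on `V(Q)_{N,k}`. -/
noncomputable def coord (i : Fin N ⊕ Fin k) : CoordRing A B C N k :=
  Ideal.Quotient.mk _ (MvPolynomial.X i)

theorem map_genericE : (Ideal.Quotient.mk (idealV A B C N k)).mapMatrix (genericE K N k) =
    matE (fun i => coord A B C N k (Sum.inl i)) (fun j => coord A B C N k (Sum.inr j)) :=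
  map_matE _ _ _

theorem proportional : Proportional A B C
    (matE (fun i => coord A B C N k (Sum.inl i)) (fun j => coord A B C N k (Sum.inr j))) := by
  rw [← map_genericE]
  have hC : ∀ c, algebraMap K (CoordRing A B C N k) c =
      Ideal.Quotient.mk (idealV A B C N k) (MvPolynomial.C c) := fun _ => rfl
  simp only [Proportional, RingHom.mapMatrix_apply, Matrix.map_apply, hC, ← map_sub, ← map_mul,
    ← map_neg]
  refine ⟨Ideal.Quotient.eq.2 ?_, Ideal.Quotient.eq.2 ?_, Ideal.Quotient.eq.2 ?_⟩ <;>
    exact Ideal.subset_span (by simp)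

variable {A B C N k} {G : Type*} [CommRing G] [Algebra K G]

/-- The homomorphism defined by a point of `V(Q)_{N,k}`. -/
noncomputable def lift (b : Fin N → G) (a : Fin k → G) (h : Proportional A B C (matE b a)) :
    CoordRing A B C N k →ₐ[K] G :=
  Ideal.Quotient.liftₐ _ (MvPolynomial.aeval (Sum.elim b a)) (by
    have hE : (MvPolynomial.aeval (R := K) (Sum.elim b a)).toRingHom.mapMatrix (genericE K N k) =
        matE b a := by
      rw [genericE, map_matE]
      congr 1 <;> ext i <;> simp
    have hE' : ∀ i j, MvPolynomial.aeval (R := K) (Sum.elim b a) (genericE K N k i j) =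
        matE b a i j := fun i j => congr_fun₂ hE i j
    suffices hle : idealV A B C N k ≤
        RingHom.ker (MvPolynomial.aeval (R := K) (Sum.elim b a)) from fun p hp => hle hp
    obtain ⟨h1, h2, h3⟩ := h
    rw [idealV, Ideal.span_le]
    rintro p (rfl | rfl | rfl) <;>
      simp only [SetLike.mem_coe, RingHom.mem_ker, map_sub, map_mul, map_neg, hE',
        MvPolynomial.aeval_C]
    · linear_combination h1
    · linear_combination h2
    · linear_combination h3)

@[simp] theorem lift_coord (b : Fin N → G) (a : Fin k → G) (h : Proportional A B C (matE b a))
    (i : Fin N ⊕ Fin k) : lift b a h (coord A B C N k i) = Sum.elim b a i := by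
  change MvPolynomial.aeval (R := K) (Sum.elim b a) (MvPolynomial.X i) = _
  simp

/-- A homomorphism to the coordinate ring is surjective if its image contains the constants and the
coordinate functions. -/
theorem surjective_of_coord {S : Type*} [CommRing S] (g : S →+* CoordRing A B C N k)
    (hK : ∀ c : K, algebraMap K _ c ∈ g.range) (hcoord : ∀ i, coord A B C N k i ∈ g.range) :
    Function.Surjective g := by
  intro q
  obtain ⟨p, rfl⟩ := Ideal.Quotient.mk_surjective q
  change Ideal.Quotient.mk _ p ∈ g.range
  induction p using MvPolynomial.induction_on with
  | C c => exact hK c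
  | add p q hp hq => rw [map_add]; exact add_mem hp hq
  | mul_X p i hp => rw [map_mul]; exact mul_mem hp (hcoord i)

end CoordRing

end CoordinateRing

/-! ### V as a hypersurface over FP × affine space -/

section Parametrization

variable {K : Type u} [Field K] (A B C : K)

/-- The coordinate ring of the Fermat-Pell curve, in the coordinates `x, y` of `pellMatrix`. -/
abbrev PellRing (k : ℕ) : Type u := ConicRing B (A * C) ((-1) ^ k)

/-- A and B cannot both vanish when the discriminant is nonzero. -/
theorem exists_combination (hΔ : B ^ 2 - 4 * (A * C) ≠ 0) :
    ∃ α β γ : K, α * A + β * B + γ * C = 1 := by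
  by_cases hA : A = 0
  · by_cases hB : B = 0
    · exact absurd (by simp [hA, hB]) hΔ
    · exact ⟨0, B⁻¹, 0, by simp [hB]⟩
  · exact ⟨A⁻¹, 0, 0, by simp [hA]⟩

variable (N m : ℕ)

/-- The coordinate ring of the product of the Fermat-Pell curve with the affine space with
coordinates `b₁, …, b_N` and the last `m` of the `m + 4` variables `aⱼ`. -/
abbrev TailRing : Type u := MvPolynomial (Fin N ⊕ Fin m) (PellRing A B C (m + 4))

/-- The generic point of the Fermat-Pell curve. -/
noncomputable def genericPell : Matrix (Fin 2) (Fin 2) (PellRing A B C (m + 4)) :=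
  pellMatrix (algebraMap K _ A) (algebraMap K _ B) (algebraMap K _ C)
    (ConicRing.x _ _ _) (ConicRing.y _ _ _)

theorem det_genericPell : (genericPell A B C m).det = (-1) ^ m := by
  have h := ConicRing.equation B (A * C) ((-1) ^ (m + 4))
  rw [genericPell, det_pellMatrix, ← map_mul, h, map_pow, map_neg, map_one, pow_add,
    Even.neg_one_pow (n := 4) ⟨2, rfl⟩, mul_one]

/-- The product `D(a₀) D(a₁) D(a₂) D(a₃)` as a matrix over `TailRing`. -/
noncomputable def tailMatrix : Matrix (Fin 2) (Fin 2) (TailRing A B C N m) :=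
  headMatrix (fun i => MvPolynomial.X (Sum.inl i))
    (MvPolynomial.C.mapMatrix (genericPell A B C m)) (fun j => MvPolynomial.X (Sum.inr j))

theorem det_tailMatrix : (tailMatrix A B C N m).det = 1 := by
  rw [tailMatrix, det_headMatrix, ← RingHom.map_det, det_genericPell, map_pow, map_neg, map_one,
    ← pow_add]
  exact Even.neg_one_pow ⟨m, rfl⟩

/-- Specialize all bᵢ to 0, which leaves x or x + By as the lower right entry before the tail
factors, and then choose constants for the tail variables. A tail variable is what allows the value
1 to be avoided; this is where k ≥ 5 enters. -/
theorem tailMatrix_apply_ne [CharZero K] [IsDomain (PellRing A B C (m + 4))] (hm : m ≠ 0) :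
    tailMatrix A B C N m 1 1 ≠ 0 ∧ tailMatrix A B C N m 1 1 ≠ 1 := by
  have : Infinite (PellRing A B C (m + 4)) :=
    Infinite.of_injective _ (algebraMap K (PellRing A B C (m + 4))).injective
  set M := genericPell A B C m with hM
  have h0 : (prodDInv (fun _ : Fin N => (0 : PellRing A B C (m + 4))) * M *
      prodD (fun _ : Fin N => (0 : PellRing A B C (m + 4))) : Matrix (Fin 2) (Fin 2) _) 1 1 ≠ 0 := by
    rcases prodDInv_conj_prodD_zero M N with h | h <;> rw [h]
    · exact ConicRing.x_add_mul_y_ne_zero _ _ _ B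
    · exact ConicRing.x_ne_zero _ _ _
  obtain ⟨c, hc0, hc1⟩ := exists_mul_prodDInv_apply_ne h0 m
  let ev : TailRing A B C N m →+* PellRing A B C (m + 4) :=
    MvPolynomial.eval₂Hom (RingHom.id _) (Sum.elim (fun _ => 0) c)
  have hev : ev.mapMatrix (tailMatrix A B C N m) = headMatrix (fun _ : Fin N => 0) M c := by
    rw [tailMatrix, map_headMatrix]
    congr 1
    · ext i; simp [ev]
    · ext i j; simp [ev, hM]
    · ext i; simp [ev]
  have hev' : ev (tailMatrix A B C N m 1 1) = headMatrix (fun _ : Fin N => 0) M c 1 1 :=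
    congr_fun₂ hev 1 1
  constructor
  · intro h
    rw [h, map_zero] at hev'
    exact hc0 hev'.symm
  · intro h
    rw [h, map_one] at hev'
    exact hc1 hm hev'.symm

open Polynomial

/-- The product `D(a₀) D(a₁) D(a₂)` as a matrix over the polynomial ring in `a₃` over `TailRing`. -/
noncomputable def triple : Matrix (Fin 2) (Fin 2) (TailRing A B C N m)[X] :=
  headMatrix (fun i => Polynomial.C (MvPolynomial.X (Sum.inl i)))
    ((Polynomial.C.comp MvPolynomial.C).mapMatrix (genericPell A B C m))
    (Fin.cons X fun j => Polynomial.C (MvPolynomial.X (Sum.inr j)))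

theorem triple_eq : triple A B C N m =
    Polynomial.C.mapMatrix (tailMatrix A B C N m) * !![0, 1; 1, -X] := by
  rw [triple, headMatrix_succ, tailMatrix, map_headMatrix]
  rfl

theorem det_triple : (triple A B C N m).det = -1 := by
  rw [triple_eq, Matrix.det_mul, ← RingHom.map_det, det_tailMatrix]
  simp

theorem mapMatrix_C_mul_apply_one {S : Type*} [CommRing S] (M : Matrix (Fin 2) (Fin 2) S)
    (i : Fin 2) : (Polynomial.C.mapMatrix M * !![0, 1; 1, -X] : Matrix (Fin 2) (Fin 2) S[X]) i 1 =
      Polynomial.C (M i 0) - Polynomial.C (M i 1) * X := by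
  simp [Matrix.mul_apply, Fin.sum_univ_two, sub_eq_add_neg]

theorem triple_apply_one (i : Fin 2) : triple A B C N m i 1 =
    Polynomial.C (tailMatrix A B C N m i 0) - Polynomial.C (tailMatrix A B C N m i 1) * X := by
  rw [triple_eq, mapMatrix_C_mul_apply_one]

theorem triple_apply_one_one_ne_zero [CharZero K] [IsDomain (PellRing A B C (m + 4))]
    (hm : m ≠ 0) : triple A B C N m 1 1 ≠ 0 := by
  rw [triple_apply_one]
  intro h
  have := congrArg (coeff · 1) h
  simp [coeff_C] at this
  exact (tailMatrix_apply_ne A B C N m hm).1 this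

theorem triple_regular [CharZero K] [IsDomain (PellRing A B C (m + 4))] (hm : m ≠ 0)
    (z : (TailRing A B C N m)[X])
    (hz : triple A B C N m 1 1 ∣ z * (triple A B C N m 0 1 - 1)) : triple A B C N m 1 1 ∣ z := by
  obtain ⟨h0, h1⟩ := tailMatrix_apply_ne A B C N m hm
  rw [triple_apply_one, triple_apply_one] at hz
  rw [triple_apply_one]
  refine linear_dvd_of_dvd_mul ?_ h0 h1 z hz
  rw [← det_tailMatrix A B C N m, Matrix.det_fin_two]

theorem pellMatrix_equation {G : Type*} [CommRing G] [Algebra K G] {k : ℕ} {x y : G}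
    (h : (pellMatrix (algebraMap K G A) (algebraMap K G B) (algebraMap K G C) x y).det =
      (-1) ^ k) :
    x ^ 2 + algebraMap K G B * x * y + algebraMap K G (A * C) * y ^ 2 =
      algebraMap K G ((-1) ^ k) := by
  rw [det_pellMatrix] at h
  rw [map_mul, h]
  simp

variable {A B C} in
/-- The coordinate ring of `V(Q)_{N, m + 4}` embeds into the function field of the product of the
Fermat-Pell curve with an affine space, with image containing the coordinate ring of the product. -/
theorem exists_coordRing_embedding [CharZero K] [IsDomain (PellRing A B C (m + 4))]
    (hΔ : B ^ 2 - 4 * (A * C) ≠ 0) (hm : m ≠ 0) (L : Type*) [Field L] [Algebra K L]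
    [Algebra (TailRing A B C N m)[X] L] [IsScalarTower K (TailRing A B C N m)[X] L]
    [IsFractionRing (TailRing A B C N m)[X] L] :
    ∃ f : CoordRing A B C N (m + 4) →ₐ[K] L, Function.Injective f ∧
      ∀ z, ∃ q, f q = algebraMap (TailRing A B C N m)[X] L z := by
  let ι := algebraMap (TailRing A B C N m)[X] L
  obtain ⟨P, hPdef⟩ : ∃ P, P = triple A B C N m := ⟨_, rfl⟩
  have hι : Function.Injective ι := IsFractionRing.injective _ _
  have hp : P 1 1 ≠ 0 := hPdef ▸ triple_apply_one_one_ne_zero A B C N m hm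
  have hpL : ι (P 1 1) ≠ 0 := by rwa [Ne, map_eq_zero_iff ι hι]
  -- the point of `V(Q)_{N, m + 4}` over `L`
  let a₀ : L := ι (P 0 1 - 1) / ι (P 1 1)
  let PL := ι.mapMatrix P
  have hPL : ∀ i j, PL i j = ι (P i j) := fun _ _ => rfl
  have hdet : PL.det = -1 := by
    rw [← RingHom.map_det, hPdef, det_triple, map_neg, map_one]
  have ha₀ : PL 1 1 * a₀ = PL 0 1 - 1 := by
    simp only [hPL, a₀, map_sub, map_one]
    field_simp
  let bL : Fin N → L := fun i => ι (Polynomial.C (MvPolynomial.X (Sum.inl i)))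
  let cL : Fin (m + 1) → L :=
    Fin.cons (ι X) fun j => ι (Polynomial.C (MvPolynomial.X (Sum.inr j)))
  let ML : Matrix (Fin 2) (Fin 2) L :=
    (ι.comp (Polynomial.C.comp MvPolynomial.C)).mapMatrix (genericPell A B C m)
  have hPhead : PL = headMatrix bL ML cL := by
    simp only [PL, hPdef, triple, map_headMatrix]
    congr 1
    ext j
    refine Fin.cases ?_ (fun j => ?_) j <;> rfl
  let κ : PellRing A B C (m + 4) →+* L := ι.comp (Polynomial.C.comp MvPolynomial.C)
  have hκ : ∀ c, κ (algebraMap K _ c) = algebraMap K L c := fun c =>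
    (IsScalarTower.algebraMap_apply K (TailRing A B C N m)[X] L c).symm
  have hML : ML = pellMatrix (algebraMap K L A) (algebraMap K L B) (algebraMap K L C)
      (κ (ConicRing.x _ _ _)) (κ (ConicRing.y _ _ _)) := by
    simp only [ML, genericPell]
    rw [map_pellMatrix, hκ, hκ, hκ]
  -- The entries after a₀ are those forced by D(a₀)D(a₁)D(a₂) = P.
  let aL : Fin (m + 4) → L :=
    Fin.cons a₀ (Fin.cons (PL 1 1) (Fin.cons (PL 0 0 - a₀ * PL 1 0) cL : Fin (m + 2) → L) :
      Fin (m + 3) → L)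
  have hE : matE bL aL = ML :=
    matE_cons_eq bL ML cL ((D_mul_D_mul_D_eq hdet ha₀).trans hPhead)
  let f : CoordRing A B C N (m + 4) →ₐ[K] L := CoordRing.lift bL aL (by
    rw [hE, hML]; exact proportional_pellMatrix A B C _ _)
  have hf : ∀ i, f (CoordRing.coord A B C N (m + 4) i) = Sum.elim bL aL i :=
    CoordRing.lift_coord _ _ _
  -- the universal point of `V(Q)_{N, m + 4}`
  let b : Fin N → CoordRing A B C N (m + 4) := fun i => CoordRing.coord A B C N (m + 4) (Sum.inl i)
  let a : Fin (m + 4) → CoordRing A B C N (m + 4) := fun i => CoordRing.coord A B C N (m + 4) (Sum.inr i)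
  obtain ⟨α, β, γ, hαβγ⟩ := exists_combination A B C hΔ
  have hαβγR := congrArg (algebraMap K (CoordRing A B C N (m + 4))) hαβγ
  simp only [map_add, map_mul, map_one] at hαβγR
  -- The entries M₁₀, M₁₁ - M₀₀, -M₀₁ are Ay, By, Cy, so αA + βB + γC = 1 recovers y polynomially.
  let yOf {G : Type u} [CommRing G] [Algebra K G] (M : Matrix (Fin 2) (Fin 2) G) : G :=
    algebraMap K G α * M 1 0 + algebraMap K G β * (M 1 1 - M 0 0) - algebraMap K G γ * M 0 1
  have hER : matE b a = pellMatrix (algebraMap K (CoordRing A B C N (m + 4)) A)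
      (algebraMap K (CoordRing A B C N (m + 4)) B) (algebraMap K (CoordRing A B C N (m + 4)) C)
      (matE b a 0 0) (yOf (matE b a)) := by
    obtain ⟨h1, h2, h3⟩ := CoordRing.proportional A B C N (m + 4)
    exact eq_pellMatrix hαβγR h1 h2 h3
  let φ : PellRing A B C (m + 4) →ₐ[K] CoordRing A B C N (m + 4) :=
    ConicRing.lift (matE b a 0 0) (yOf (matE b a))
      (pellMatrix_equation A B C (by rw [← hER, det_matE]))
  let e : TailRing A B C N m →+* CoordRing A B C N (m + 4) :=
    MvPolynomial.eval₂Hom φ.toRingHom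
      (Sum.elim b fun j => a j.succ.succ.succ.succ)
  let g₀ : (TailRing A B C N m)[X] →+* CoordRing A B C N (m + 4) := eval₂RingHom e (a 3)
  -- The inner variable stands for a₃ and the outer one for a₀; a₁ and a₂ need no variables, being
  -- polynomials in a₀ and the entries of P.
  let g : (TailRing A B C N m)[X][X] →+* CoordRing A B C N (m + 4) := eval₂RingHom g₀ (a 0)
  have hgC : ∀ z, g (Polynomial.C z) = g₀ z := fun z => eval₂_C _ _
  have hgX : g X = a 0 := eval₂_X _ _
  have hg₀X : g₀ X = a 3 := eval₂_X _ _
  have hg₀C : ∀ z, g₀ (Polynomial.C (MvPolynomial.C z)) = φ z := fun z =>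
    (eval₂_C _ _).trans (MvPolynomial.eval₂Hom_C _ _ z)
  have hg₀b : ∀ i, g₀ (Polynomial.C (MvPolynomial.X (Sum.inl i))) = b i := fun i =>
    (eval₂_C _ _).trans (MvPolynomial.eval₂Hom_X' _ _ _)
  have hg₀a : ∀ j, g₀ (Polynomial.C (MvPolynomial.X (Sum.inr j))) = a j.succ.succ.succ.succ :=
    fun j => (eval₂_C _ _).trans (MvPolynomial.eval₂Hom_X' _ _ _)
  have hφM : φ.toRingHom.mapMatrix (genericPell A B C m) = matE b a := by
    rw [genericPell, map_pellMatrix, hER]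
    simp [φ]
  have hg₀P : g₀.mapMatrix P = D (a 0) * (D (a 1) * D (a 2)) := by
    rw [← headMatrix_matE b a, ← hφM]
    simp only [hPdef, triple, map_headMatrix]
    congr 1
    · ext i; exact hg₀b i
    · ext i j; exact hg₀C _
    · ext j
      refine Fin.cases ?_ (fun j => ?_) j
      · exact hg₀X
      · exact hg₀a j
  have hgP : ∀ i j, g₀ (P i j) = (D (a 0) * (D (a 1) * D (a 2))) i j :=
    fun i j => congr_fun₂ hg₀P i j
  rw [D_mul_D_mul_D] at hgP
  have hgsurj : Function.Surjective g := by
    refine CoordRing.surjective_of_coord (S := (TailRing A B C N m)[X][X]) g ?_ ?_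
    · intro c
      refine ⟨Polynomial.C (Polynomial.C (MvPolynomial.C (algebraMap K _ c))), ?_⟩
      rw [hgC, hg₀C, AlgHom.commutes]
    · rintro (i | j)
      · exact ⟨Polynomial.C (Polynomial.C (MvPolynomial.X (Sum.inl i))),
          (hgC _).trans (hg₀b i)⟩
      · change ∃ w, g w = a j
        refine Fin.cases ⟨X, hgX⟩ (fun j => ?_) j
        refine Fin.cases ⟨Polynomial.C (P 1 1), ?_⟩ (fun j => ?_) j
        · rw [hgC, hgP]; simp
        refine Fin.cases ⟨Polynomial.C (P 0 0) - X * Polynomial.C (P 1 0), ?_⟩ (fun j => ?_) j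
        · rw [map_sub g, map_mul g, hgC, hgC, hgP, hgP, hgX]; simp
        refine Fin.cases ⟨Polynomial.C X, (hgC _).trans hg₀X⟩ (fun j => ?_) j
        exact ⟨Polynomial.C (Polynomial.C (MvPolynomial.X (Sum.inr j))),
          (hgC _).trans (hg₀a j)⟩
  have hgrel : g (Polynomial.C (P 1 1) * X - Polynomial.C (P 0 1 - 1)) = 0 := by
    rw [map_sub g, map_mul g, hgC, hgC, hgX, map_sub g₀, map_one g₀, hgP, hgP]
    simp [mul_comm]
  -- comparison
  have hfE : ∀ i j, f (matE b a i j) = ML i j := by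
    have : f.toRingHom.mapMatrix (matE b a) = ML := by
      rw [map_matE, ← hE]
      congr 1
      · ext i; exact hf _
      · ext i; exact hf _
    exact fun i j => congr_fun₂ this i j
  have hfφ : ∀ z, f (φ z) = κ z := by
    let κ' : PellRing A B C (m + 4) →ₐ[K] L := { κ with commutes' := hκ }
    have : f.comp φ = κ' := by
      apply ConicRing.algHom_ext
      · simp only [AlgHom.comp_apply, φ, ConicRing.lift_x, hfE, hML]
        simp [pellMatrix, κ']
      · have hαβγL := congrArg (algebraMap K L) hαβγ
        simp only [map_add, map_mul, map_one] at hαβγL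
        simp only [AlgHom.comp_apply, φ, ConicRing.lift_y, yOf, map_add, map_sub, map_mul, hfE,
          AlgHom.commutes, hML]
        simp only [pellMatrix, Matrix.of_apply, Matrix.cons_val', Matrix.cons_val_zero,
          Matrix.cons_val_one, Matrix.cons_val_fin_one]
        change _ = κ (ConicRing.y _ _ _)
        linear_combination κ (ConicRing.y _ _ _) * hαβγL
    exact fun z => congr($this z)
  have hfg₀ : f.toRingHom.comp g₀ = ι := by
    apply Polynomial.ringHom_ext'
    · apply MvPolynomial.ringHom_ext'
      · refine RingHom.ext fun z => ?_
        change f (g₀ (Polynomial.C (MvPolynomial.C z))) = _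
        rw [hg₀C, hfφ]; rfl
      · rintro (i | j)
        · change f (g₀ (Polynomial.C (MvPolynomial.X (Sum.inl i)))) = _
          rw [hg₀b]; exact hf _
        · change f (g₀ (Polynomial.C (MvPolynomial.X (Sum.inr j)))) = _
          rw [hg₀a]; exact hf _
    · change f (g₀ X) = _
      rw [hg₀X]; exact hf _
  have hfg : ∀ w, f (g w) = aeval (ι (P 0 1 - 1) / ι (P 1 1)) w := by
    have : f.toRingHom.comp g = (aeval (R := (TailRing A B C N m)[X]) (ι (P 0 1 - 1) / ι (P 1 1))).toRingHom := by
      apply Polynomial.ringHom_ext'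
      · refine RingHom.ext fun z => ?_
        change f (g (Polynomial.C z)) = aeval (R := (TailRing A B C N m)[X]) _ (Polynomial.C z)
        rw [hgC, aeval_C]
        exact congr($hfg₀ z)
      · change f (g X) = aeval (R := (TailRing A B C N m)[X]) _ X
        rw [hgX, aeval_X]; exact hf _
    exact fun w => congr($this w)
  refine ⟨f, (injective_iff_map_eq_zero f).2 fun q hq => ?_, fun z => ⟨g₀ z, congr($hfg₀ z)⟩⟩
  -- The composite of f with the surjection g is evaluation at r/p; its kernel is generated by pX -
  -- r, which g already kills. Hence f is injective.
  obtain ⟨w, rfl⟩ := hgsurj q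
  rw [hfg] at hq
  obtain ⟨w', rfl⟩ := dvd_of_aeval_div_eq_zero hp (hPdef ▸ triple_regular A B C N m hm) w hq
  rw [map_mul, hgrel, zero_mul]

end Parametrization

/-! ### Integrality and rationality -/

section Main

open AlgebraicGeometry CategoryTheory Polynomial

variable {K : Type u} [Field K] {A B C : K}

/-- The coordinates of a point of the Fermat-Pell curve satisfy the equation of a conic. -/
theorem exists_conic_point (hΔ : B ^ 2 - 4 * (A * C) ≠ 0) {k : ℕ}
    (h : (fermatPell A B C k).Nonempty) :
    ∃ x y : K, x ^ 2 + B * x * y + A * C * y ^ 2 = (-1) ^ k := by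
  obtain ⟨M, h0, h1, h2, h3⟩ := h
  obtain ⟨α, β, γ, hαβγ⟩ := exists_combination A B C hΔ
  refine ⟨M 0 0, α * M 1 0 + β * (M 1 1 - M 0 0) - γ * M 0 1, ?_⟩
  rw [← det_pellMatrix, ← eq_pellMatrix hαβγ h1 h2 h3, Matrix.det_fin_two, h0]

variable [CharZero K]

theorem isDomain_pellRing (hΔ : B ^ 2 - 4 * (A * C) ≠ 0) (k : ℕ) : IsDomain (PellRing A B C k) :=
  isDomain_conicRing hΔ (pow_ne_zero _ (neg_ne_zero.2 one_ne_zero))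

theorem isDomain_coordRing (hΔ : B ^ 2 - 4 * (A * C) ≠ 0) (N : ℕ) {m : ℕ} (hm : m ≠ 0) :
    IsDomain (CoordRing A B C N (m + 4)) := by
  have := isDomain_pellRing hΔ (m + 4)
  obtain ⟨f, hf, -⟩ :=
    exists_coordRing_embedding N m hΔ hm (FractionRing (TailRing A B C N m)[X])
  exact hf.isDomain f.toRingHom

/-- `𝔸¹ × 𝔸^σ × 𝔸¹` is an affine space. -/
theorem exists_algEquiv_mvPolynomial (K : Type u) [Field K] (σ : Type) :
    ∃ τ : Type u, Nonempty ((MvPolynomial σ K[X])[X] ≃ₐ[K] MvPolynomial τ K) :=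
  ⟨ULift (Option (Option σ)),
    ⟨(Polynomial.mapAlgEquiv (MvPolynomial.optionEquivRight K σ).symm).trans
      ((MvPolynomial.optionEquivLeft K (Option σ)).symm.trans
        (MvPolynomial.renameEquiv K Equiv.ulift.symm))⟩⟩

theorem isRationalOver_structureMap (hΔ : B ^ 2 - 4 * (A * C) ≠ 0) (N : ℕ) {m : ℕ} (hm : m ≠ 0)
    (h : (fermatPell A B C (m + 4)).Nonempty) :
    Scheme.IsRationalOver (V.structureMap A B C N (m + 4)) := by
  have := isDomain_pellRing hΔ (m + 4)
  have := isDomain_coordRing hΔ N hm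
  obtain ⟨x₀, y₀, h₀⟩ := exists_conic_point hΔ h
  obtain ⟨φ, hφ, hφfrac⟩ := ConicRing.exists_parametrization hΔ
    (pow_ne_zero _ (neg_ne_zero.2 one_ne_zero)) h₀
  have : Algebra.FiniteType K (TailRing A B C N m) :=
    Algebra.FiniteType.trans (S := PellRing A B C (m + 4)) inferInstance inferInstance
  have : Algebra.FiniteType K (TailRing A B C N m)[X] :=
    Algebra.FiniteType.trans (S := TailRing A B C N m) inferInstance inferInstance
  have : Algebra.FiniteType K (MvPolynomial (Fin N ⊕ Fin m) K[X]) :=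
    Algebra.FiniteType.trans (S := K[X]) inferInstance inferInstance
  have : Algebra.FiniteType K (MvPolynomial (Fin N ⊕ Fin m) K[X])[X] :=
    Algebra.FiniteType.trans (S := MvPolynomial (Fin N ⊕ Fin m) K[X]) inferInstance inferInstance
  -- `V(Q)_{N, m + 4}` is birational to the product of the Fermat-Pell curve and an affine space
  have hbir₁ : Scheme.BirationalOver (V.structureMap A B C N (m + 4))
      (Spec.map (CommRingCat.ofHom (algebraMap K (TailRing A B C N m)[X]))) := by
    let L := FractionRing (TailRing A B C N m)[X]
    obtain ⟨f, hf, hfT⟩ := exists_coordRing_embedding N m hΔ hm L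
    refine birationalOver_of_common_fractions
      (IsScalarTower.toAlgHom K (TailRing A B C N m)[X] L) f
      (IsFractionRing.injective (TailRing A B C N m)[X] L) hf isFractionOf_toAlgHom fun z => ?_
    obtain ⟨a, b, -, rfl⟩ := IsFractionRing.div_surjective (A := (TailRing A B C N m)[X]) z
    obtain ⟨a', ha⟩ := hfT a
    obtain ⟨b', hb⟩ := hfT b
    rw [← ha, ← hb]
    exact .of_div a' b'
  -- the Fermat-Pell curve is birational to a line
  have hbir₂ : Scheme.BirationalOver
      (Spec.map (CommRingCat.ofHom (algebraMap K (TailRing A B C N m)[X])))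
      (Spec.map (CommRingCat.ofHom (S := (MvPolynomial (Fin N ⊕ Fin m) K[X])[X])
        (algebraMap K (MvPolynomial (Fin N ⊕ Fin m) K[X])[X]))) := by
    let M := (MvPolynomial (Fin N ⊕ Fin m) (RatFunc K))[X]
    let j : M →ₐ[K] FractionRing M := IsScalarTower.toAlgHom K M (FractionRing M)
    have hj : Function.Injective j := IsFractionRing.injective M (FractionRing M)
    let ψ := IsScalarTower.toAlgHom K K[X] (RatFunc K)
    have hψ : Function.Injective ψ := IsFractionRing.injective K[X] (RatFunc K)
    -- Applied to the conic ring and to K[t], both with fractions filling K(t); adjoining the same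
    -- variables places both products in one function field.
    have key : ∀ {R : Type u} [CommRing R] [IsDomain R] [Algebra K R] (χ : R →ₐ[K] RatFunc K),
        Function.Injective χ → (∀ z, IsFractionOf χ z) →
        Function.Injective (j.comp
          (Polynomial.mapAlgHom (MvPolynomial.mapAlgHom (σ := Fin N ⊕ Fin m) χ))) ∧
        ∀ z, IsFractionOf (j.comp
          (Polynomial.mapAlgHom (MvPolynomial.mapAlgHom (σ := Fin N ⊕ Fin m) χ))) z := by
      intro R _ _ _ χ hχ hfrac
      have hinj : Function.Injective
          (Polynomial.mapAlgHom (MvPolynomial.mapAlgHom (σ := Fin N ⊕ Fin m) χ)) :=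
        Polynomial.map_injective _ (MvPolynomial.map_injective _ hχ)
      exact ⟨hj.comp hinj, fun z => (isFractionOf_toAlgHom z).trans hinj
        (IsFractionOf.polynomial_map (IsFractionOf.mvPolynomial_map hfrac))⟩
    obtain ⟨h1, h2⟩ := key φ hφ hφfrac
    obtain ⟨h3, h4⟩ := key ψ hψ isFractionOf_toAlgHom
    exact birationalOver_of_common_fractions _ _ h3 h1 h4 h2
  obtain ⟨τ, ⟨e⟩⟩ := exists_algEquiv_mvPolynomial K (Fin N ⊕ Fin m)
  have := isRationalOver_Spec_mvPolynomial K τ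
  exact ((hbir₁.trans hbir₂).trans (birationalOver_of_algEquiv e.symm)).isRationalOver

/-- For `k ≥ 5` the variety `V(Q)_{N,k}` is integral, and it is rational as soon as the Fermat-Pell
curve has a rational point. -/
theorem isIntegral_and_isRationalOver (hΔ : discrim A B C ≠ 0) (N : ℕ) {k : ℕ} (hk : 5 ≤ k) :
    IsIntegral (V A B C N k) ∧
      ((fermatPell A B C k).Nonempty → Scheme.IsRationalOver (V.structureMap A B C N k)) := by
  -- m counts the aⱼ left after a₀, …, a₃, so k ≥ 5 means m ≠ 0.
  obtain ⟨m, rfl⟩ : ∃ m, k = m + 4 := ⟨k - 4, by omega⟩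
  have hm : m ≠ 0 := by omega
  have hΔ' : B ^ 2 - 4 * (A * C) ≠ 0 := by rwa [discrim, mul_assoc] at hΔ
  have := isDomain_coordRing hΔ' N hm
  exact ⟨inferInstanceAs (IsIntegral (Spec (CommRingCat.of (CoordRing A B C N (m + 4))))),
    isRationalOver_structureMap hΔ' N hm⟩

end Main

end PCF

theorem theorem5p4 {K : Type*} [Field K] [NumberField K]
    (S : Set (IsDedekindDomain.HeightOneSpectrum (NumberField.RingOfIntegers K)))
    (hS : S.Finite) (A B C : S.integer K) (hQ : discrim A B C ≠ 0) (k : ℕ) :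
    (5 ≤ k →
      AlgebraicGeometry.IsIntegral (PCF.V (A : K) (B : K) (C : K) 1 k) ∧
      ((PCF.fermatPell (A : K) (B : K) (C : K) k).Nonempty →
        AlgebraicGeometry.Scheme.IsRationalOver
          (PCF.V.structureMap (A : K) (B : K) (C : K) 1 k))) ∧
    (6 ≤ k →
      AlgebraicGeometry.IsIntegral (PCF.V (A : K) (B : K) (C : K) 0 k) ∧
      ((PCF.fermatPell (A : K) (B : K) (C : K) k).Nonempty →
        AlgebraicGeometry.Scheme.IsRationalOver
          (PCF.V.structureMap (A : K) (B : K) (C : K) 0 k))) := by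
  have hQ' : discrim (A : K) B C ≠ 0 := fun h => hQ (Subtype.ext h)
  exact ⟨PCF.isIntegral_and_isRationalOver hQ' 1,
    fun hk => PCF.isIntegral_and_isRationalOver hQ' 0 (by omega)⟩
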